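/- Let $L\ge 1$, $d'\ge 3$, $d=Ld'$ and $m\ge 1$ be integers. For a finite nonempty family $S$ of unit vectors in $\mathbb R^d$ and $v\in\mathbb S^{d-1}$, let $Z_S(v)\in\operatorname{argmax}_{u\in S}\langle u,v\rangle$ and $A_S(v)=\langle v,Z_S(v)\rangle$ (the cosine of the reference angle). Let $J(S)=\mathbb E[A_S(v)]$, where $v$ is uniformly distributed on $\mathbb S^{d-1}$. If $S$ is random, then $v$ is independent of $S$ and $J(S)$ denotes the expectation over both $S$ and $v$. Let $S_{\mathrm{ran}}(m,L)$ be the following random configuration: for each level $l=1,\dots,L$ draw $m$ points of $\mathbb S^{d'-1}$ uniformly, all draws (also across levels) being independent; scale all points to norm $1/\sqrt L$; the configuration consists of the $m^L$ unit vectors of $\mathbb R^d=(\mathbb R^{d'})^L$ obtained by concatenating one scaled point from each level. For even $m$, let $S_{\mathrm{sym}}(m,L)$ be obtained in the same way, except that the $m$ points of each level are $m/2$ independent uniform points of $\mathbb S^{d'-1}$ together with their antipodal points. Put $$c_{d'}=\frac{\Gamma(\frac{d'}{2})}{\sqrt{\pi}\,\Gamma(\frac{d'-1}{2})},\qquad f(y)=c_{d'}(1-y^2)^{\frac{d'-3}{2}},\qquad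 F(y)=\int_{-1}^y f(t)\,dt \qquad (y\in[-1,1]),$$ $$B(m,L)=m\sqrt{L}\;\frac{\Gamma(\frac{d+L}{2L})\,\Gamma(\frac d2)}{\Gamma(\frac{d}{2L})\,\Gamma(\frac{d+1}{2})}\int_{-1}^1 y\,F(y)^{m-1}f(y)\,dy .$$ Then: 1. if $m$ is even, $J(S_{\mathrm{sym}}(m,L))>B(m,L)$; 2. $J(S_{\mathrm{ran}}(m,L))=B(m,L)$; 3. for every fixed $x\in\mathbb S^{d'-1}$ and $u$ uniform on $\mathbb S^{d'-1}$, the random variable $\langle x,u\rangle$ has density $f$ on $[-1,1]$ (with respect to Lebesgue measure), and $\mathbb P(\langle x,u\rangle\le y)=F(y)$ for $y\in[-1,1]$. -/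

import Mathlib

namespace RefAngle

open MeasureTheory

noncomputable section

/-- The unit sphere of `ℝ^ι` with its Euclidean norm. -/
abbrev USphere (ι : Type*) [Fintype ι] : Type _ :=
  Metric.sphere (0 : EuclideanSpace ℝ ι) 1

/-- The uniform distribution on the unit sphere of `ℝ^ι`: the surface measure induced by Lebesgue
measure, normalized to total mass one. -/
def sphereUniform (ι : Type*) [Fintype ι] : Measure (USphere ι) :=
  ((volume : Measure (EuclideanSpace ℝ ι)).toSphere Set.univ)⁻¹ •
    (volume : Measure (EuclideanSpace ℝ ι)).toSphere

section Reference

variable {E : Type*} [NormedAddCommGroup E] [InnerProductSpace ℝ E] {κ : Type*}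

open Classical in
/-- The reference vector `Z_S(v)`: a member of the family `S` whose inner product with `v` is
maximal. (A maximizer exists for every finite nonempty family; the value `0` is used otherwise.) -/
def refVector (S : κ → E) (v : E) : E :=
  if h : ∃ i, ∀ j, inner ℝ (S j) v ≤ inner ℝ (S i) v then S h.choose else 0

/-- The cosine `A_S(v) = ⟨v, Z_S(v)⟩` of the reference angle of the unit vector `v`. -/
def refCos (S : κ → E) (v : E) : ℝ :=
  inner ℝ v (refVector S v)

end Reference

/-- `J(S) = 𝔼_v [A_S(v)]` with `v` uniformly distributed on the unit sphere. -/
def J {ι κ : Type*} [Fintype ι] (S : κ → EuclideanSpace ℝ ι) : ℝ :=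
  ∫ v : USphere ι, refCos S (v : EuclideanSpace ℝ ι) ∂(sphereUniform ι)

/-- The multi-level configuration obtained from one family `w l` of points on the unit sphere of
`ℝ^d'` per level `l`: all points are scaled to norm `1/√L`, and one point per level is selected
(in all possible ways `k`) and the selected points are concatenated. The ambient space `ℝ^(L d')`
has its coordinates indexed by pairs (level, coordinate within the level). -/
def multiLevel {L d' : ℕ} {κ : Type*} (w : Fin L → κ → USphere (Fin d')) :
    (Fin L → κ) → EuclideanSpace ℝ (Fin L × Fin d') :=
  fun k => WithLp.toLp 2 fun p =>
    (1 / Real.sqrt L) * (w p.1 (k p.1) : EuclideanSpace ℝ (Fin d')) p.2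

/-- The family consisting of the points `w i` along with their antipodal points `-w i`. -/
def antipodal {d' : ℕ} {κ : Type*} (w : κ → USphere (Fin d')) : κ ⊕ κ → USphere (Fin d') :=
  Sum.elim w fun i => -w i

/-- `J(S_ran(m,L))`: in each of the `L` levels, `m` independent uniform points on the unit sphere
of `ℝ^d'`; the expectation is over the random configuration and the random vector `v`. -/
def JRan (d' m L : ℕ) : ℝ :=
  ∫ w : Fin L → Fin m → USphere (Fin d'), J (multiLevel w)
    ∂(Measure.pi fun _ => Measure.pi fun _ => sphereUniform (Fin d'))

/-- `J(S_sym(m,L))` for even `m`: in each of the `L` levels, `m/2` independent uniform points on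
the unit sphere of `ℝ^d'` along with their antipodal points; the expectation is over the random
configuration and the random vector `v`. -/
def JSym (d' m L : ℕ) : ℝ :=
  ∫ w : Fin L → Fin (m / 2) → USphere (Fin d'), J (multiLevel fun l => antipodal (w l))
    ∂(Measure.pi fun _ => Measure.pi fun _ => sphereUniform (Fin d'))

/-- `c_{d'} = Γ(d'/2) / (√π Γ((d'-1)/2))`. -/
def cosConst (d' : ℕ) : ℝ :=
  Real.Gamma ((d' : ℝ) / 2) / (Real.sqrt Real.pi * Real.Gamma (((d' : ℝ) - 1) / 2))

/-- `f(y) = c_{d'} (1 - y²)^((d'-3)/2)`. -/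
def cosDensity (d' : ℕ) (y : ℝ) : ℝ :=
  cosConst d' * (1 - y ^ 2) ^ (((d' : ℝ) - 3) / 2)

/-- `F(y) = ∫_{-1}^y f(t) dt`. -/
def cosCDF (d' : ℕ) (y : ℝ) : ℝ :=
  ∫ t in (-1 : ℝ)..y, cosDensity d' t

/-- The expression
`m √L · Γ((d+L)/(2L)) Γ(d/2) / (Γ(d/(2L)) Γ((d+1)/2)) · ∫_{-1}^1 y F(y)^(m-1) f(y) dy`. -/
def lowerBound (d d' m L : ℕ) : ℝ :=
  (m : ℝ) * Real.sqrt L *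
    ((Real.Gamma (((d : ℝ) + L) / (2 * L)) * Real.Gamma ((d : ℝ) / 2)) /
      (Real.Gamma ((d : ℝ) / (2 * L)) * Real.Gamma (((d : ℝ) + 1) / 2))) *
    ∫ y in (-1 : ℝ)..1, y * cosCDF d' y ^ (m - 1) * cosDensity d' y

end

end RefAngle

/-!
Integrals over the sphere are computed by integrating homogeneous functions against `exp (-‖x‖ ^ 2)`
in polar coordinates and along an orthogonal decomposition. This yields the density `f` of
`⟨x, u⟩` and the mean norm of one block of a uniform vector `v ∈ (ℝ^n)^L`.

For a multi-level configuration the maximal inner product with `v` decouples over the levels, and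
within a level it is homogeneous in the block `v_l`. Hence `J` is `√L` times the mean block norm
times `M`, the mean of the largest inner product of the unscaled points of one level with a fixed
unit vector. For `m` independent points `M = ∫ (1 - P(max ≤ y)) dy - 1 = 1 - ∫ F ^ m` over
`[-1, 1]`, which is `m ∫ y F ^ (m - 1) f` by parts. For `m / 2` antipodal pairs, `F ^ m` is replaced
by `P(|⟨x, u⟩| ≤ y) ^ (m / 2)`, and `P(|⟨x, u⟩| ≤ y) = max 0 (2 F - 1) ≤ F ^ 2`, strictly for
`y ∈ (-1, 0)`.
-/

namespace RefAngle

open MeasureTheory Set Module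

noncomputable section

section Polar

theorem lintegral_eq_lintegral_toSphere {E : Type*} [NormedAddCommGroup E] [NormedSpace ℝ E]
    [FiniteDimensional ℝ E] [MeasurableSpace E] [BorelSpace E] [Nontrivial E] (μ : Measure E)
    [μ.IsAddHaarMeasure] {f : E → ENNReal} (hf : Measurable f) :
    ∫⁻ x, f x ∂μ = ∫⁻ u : Metric.sphere (0 : E) 1, (∫⁻ r in Ioi (0 : ℝ),
      ENNReal.ofReal (r ^ (finrank ℝ E - 1)) * f (r • (u : E))) ∂μ.toSphere := by
  have hmeas : Measurable fun p : Metric.sphere (0 : E) 1 × Ioi (0 : ℝ) =>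
      f ((p.2 : ℝ) • (p.1 : E)) := by fun_prop
  have hpolar := μ.measurePreserving_homeomorphUnitSphereProd.lintegral_comp hmeas
  have hinv (x : ({(0 : E)}ᶜ : Set E)) :
      f (((homeomorphUnitSphereProd E x).2 : ℝ) • ((homeomorphUnitSphereProd E x).1 : E))
        = f x := by
    have hx : ‖(x : E)‖ ≠ 0 := norm_ne_zero_iff.2 x.2
    simp [smul_smul, hx]
  simp only [hinv] at hpolar
  rw [lintegral_subtype_comap (measurableSet_singleton _).compl, restrict_compl_singleton,
    lintegral_prod _ hmeas.aemeasurable] at hpolar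
  rw [hpolar]
  refine lintegral_congr fun u => ?_
  rw [Measure.volumeIoiPow, lintegral_withDensity_eq_lintegral_mul _ (by fun_prop) (by fun_prop)]
  exact lintegral_subtype_comap measurableSet_Ioi
    (fun r : ℝ => ENNReal.ofReal (r ^ (finrank ℝ E - 1)) * f (r • (u : E)))

theorem lintegral_Ioi_pow_mul_exp_neg_sq (k : ℕ) :
    ∫⁻ r in Ioi (0 : ℝ), ENNReal.ofReal (r ^ k) * ENNReal.ofReal (Real.exp (-r ^ 2)) =
      ENNReal.ofReal (Real.Gamma (((k : ℝ) + 1) / 2) / 2) := by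
  have h := integral_rpow_mul_exp_neg_rpow (p := 2) (q := k) two_pos
    (neg_one_lt_zero.trans_le k.cast_nonneg)
  simp only [Real.rpow_natCast, Real.rpow_ofNat, one_div_mul_eq_div] at h
  have hint : IntegrableOn (fun r : ℝ => r ^ k * Real.exp (-r ^ 2)) (Ioi 0) := by
    refine .of_integral_ne_zero ?_
    rw [h]
    exact (half_pos (Real.Gamma_pos_of_pos (by positivity))).ne'
  rw [← h, ofReal_integral_eq_lintegral_ofReal hint]
  · refine setLIntegral_congr_fun measurableSet_Ioi fun r hr => ?_
    rw [ENNReal.ofReal_mul (pow_nonneg (le_of_lt hr) _)]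
  · filter_upwards [ae_restrict_mem measurableSet_Ioi] with r hr
    exact mul_nonneg (pow_nonneg (le_of_lt hr) _) (Real.exp_pos _).le

theorem lintegral_upperHalfPlane_eq_polar {f : ℝ × ℝ → ENNReal} (hf : Measurable f) :
    ∫⁻ x : ℝ, ∫⁻ y in Ioi (0 : ℝ), f (x, y) = ∫⁻ θ in Ioo 0 Real.pi, ∫⁻ r in Ioi (0 : ℝ),
      ENNReal.ofReal r * f (r * Real.cos θ, r * Real.sin θ) := by
  let H : Set (ℝ × ℝ) := univ ×ˢ Ioi 0
  have hH : MeasurableSet H := MeasurableSet.univ.prod measurableSet_Ioi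
  have hmem : ∀ p ∈ polarCoord.target, (polarCoord.symm p ∈ H ↔ p ∈ Ioi 0 ×ˢ Ioo 0 Real.pi) := by
    rintro ⟨r, θ⟩ ⟨hr : 0 < r, hθ⟩
    simp only [H, polarCoord_symm_apply, mem_prod, mem_univ, true_and, mem_Ioi, hr,
      mul_pos_iff_of_pos_left, mem_Ioo]
    refine ⟨fun hs => ⟨?_, hθ.2⟩, fun h => Real.sin_pos_of_pos_of_lt_pi h.1 h.2⟩
    by_contra! hθ0
    exact hs.not_ge (Real.sin_nonpos_of_nonpos_of_neg_pi_le hθ0 hθ.1.le)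
  have htarget : Ioi 0 ×ˢ Ioo 0 Real.pi ⊆ polarCoord.target :=
    prod_mono_right (Ioo_subset_Ioo_left (neg_nonpos.2 Real.pi_pos.le))
  calc ∫⁻ x : ℝ, ∫⁻ y in Ioi (0 : ℝ), f (x, y)
      = ∫⁻ p, H.indicator f p := by
        rw [lintegral_indicator hH, Measure.volume_eq_prod, ← Measure.prod_restrict,
          lintegral_prod _ hf.aemeasurable, Measure.restrict_univ]
    _ = ∫⁻ p in polarCoord.target, (Ioi 0 ×ˢ Ioo 0 Real.pi).indicator (fun p : ℝ × ℝ =>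
          ENNReal.ofReal p.1 * f (p.1 * Real.cos p.2, p.1 * Real.sin p.2)) p := by
        rw [← lintegral_comp_polarCoord_symm]
        refine setLIntegral_congr_fun polarCoord.open_target.measurableSet fun p hp => ?_
        by_cases h : p ∈ Ioi 0 ×ˢ Ioo 0 Real.pi
        · rw [indicator_of_mem h, indicator_of_mem ((hmem p hp).2 h), smul_eq_mul,
            polarCoord_symm_apply]
        · rw [indicator_of_notMem h, indicator_of_notMem (mt (hmem p hp).1 h), smul_zero]
    _ = _ := by
        rw [setLIntegral_indicator (measurableSet_Ioi.prod measurableSet_Ioo),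
          inter_eq_left.2 htarget, Measure.volume_eq_prod, ← Measure.prod_restrict,
          lintegral_prod_symm _ (by fun_prop)]

theorem lintegral_sin_pow_mul_comp_cos (k : ℕ) (g : ℝ → ENNReal) :
    ∫⁻ θ in Ioo 0 Real.pi, ENNReal.ofReal (Real.sin θ ^ k) * g (Real.cos θ) =
      ∫⁻ y in Ioo (-1 : ℝ) 1, ENNReal.ofReal ((1 - y ^ 2) ^ (((k : ℝ) - 1) / 2)) * g y := by
  have himage : Real.cos '' Ioo 0 Real.pi = Ioo (-1) 1 := by
    rw [Real.continuousOn_cos.image_Ioo_of_strictAntiOn Real.pi_pos.le Real.strictAntiOn_cos,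
      Real.cos_pi, Real.cos_zero]
  rw [← himage, lintegral_image_eq_lintegral_abs_deriv_mul measurableSet_Ioo
    (fun θ _ => (Real.hasDerivAt_cos θ).hasDerivWithinAt)
    (Real.injOn_cos.mono Ioo_subset_Icc_self)]
  refine setLIntegral_congr_fun measurableSet_Ioo fun θ hθ => ?_
  have hs : 0 < Real.sin θ := Real.sin_pos_of_pos_of_lt_pi hθ.1 hθ.2
  have hpow : Real.sin θ * (Real.sin θ ^ 2) ^ (((k : ℝ) - 1) / 2) = Real.sin θ ^ k := by
    rw [← Real.rpow_natCast_mul hs.le, Nat.cast_ofNat, mul_div_cancel₀ _ two_ne_zero,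
      Real.rpow_sub_one hs.ne', mul_div_cancel₀ _ hs.ne', Real.rpow_natCast]
  rw [abs_neg, abs_of_pos hs, ← Real.sin_sq, ← mul_assoc, ← ENNReal.ofReal_mul hs.le, hpow]

theorem lintegral_upperHalfPlane_gaussian (k : ℕ) {g : ℝ → ENNReal} (hg : Measurable g) :
    ∫⁻ t : ℝ, ∫⁻ r in Ioi (0 : ℝ), ENNReal.ofReal (r ^ k) *
        (g (t / √(t ^ 2 + r ^ 2)) * ENNReal.ofReal (Real.exp (-(t ^ 2 + r ^ 2)))) =
      (∫⁻ y in Ioo (-1 : ℝ) 1, ENNReal.ofReal ((1 - y ^ 2) ^ (((k : ℝ) - 1) / 2)) * g y) *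
        ENNReal.ofReal (Real.Gamma (((k : ℝ) + 2) / 2) / 2) := by
  rw [lintegral_upperHalfPlane_eq_polar (f := fun p => ENNReal.ofReal (p.2 ^ k) *
      (g (p.1 / √(p.1 ^ 2 + p.2 ^ 2)) * ENNReal.ofReal (Real.exp (-(p.1 ^ 2 + p.2 ^ 2)))))
    (by fun_prop), ← lintegral_sin_pow_mul_comp_cos, ← lintegral_mul_const _ (by fun_prop)]
  refine setLIntegral_congr_fun measurableSet_Ioo fun θ _ => ?_
  have hradial := lintegral_Ioi_pow_mul_exp_neg_sq (k + 1)
  rw [show ((k + 1 : ℕ) : ℝ) + 1 = k + 2 by push_cast; ring] at hradial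
  rw [← hradial, ← lintegral_const_mul _ (by fun_prop)]
  refine setLIntegral_congr_fun measurableSet_Ioi fun r (hr : 0 < r) => ?_
  have hsq : (r * Real.cos θ) ^ 2 + (r * Real.sin θ) ^ 2 = r ^ 2 := by
    linear_combination r ^ 2 * Real.sin_sq_add_cos_sq θ
  rw [hsq, Real.sqrt_sq hr.le, mul_div_cancel_left₀ _ hr.ne', mul_pow, pow_succ' r k,
    ENNReal.ofReal_mul (pow_nonneg hr.le k), ENNReal.ofReal_mul hr.le]
  ring

end Polar

section Sphere

variable {E : Type*} [NormedAddCommGroup E] [InnerProductSpace ℝ E] [FiniteDimensional ℝ E]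

theorem finrank_orthogonal_span_singleton_add_one {x : E} (hx : x ≠ 0) :
    finrank ℝ (ℝ ∙ x)ᗮ + 1 = finrank ℝ E := by
  rw [← (ℝ ∙ x).finrank_add_finrank_orthogonal, finrank_span_singleton hx, add_comm]

theorem nontrivial_orthogonal_span_singleton (hE : 2 ≤ finrank ℝ E) {x : E} (hx : x ≠ 0) :
    Nontrivial (ℝ ∙ x)ᗮ := by
  have := finrank_orthogonal_span_singleton_add_one hx
  exact nontrivial_of_finrank_pos (R := ℝ) (by omega)

variable [MeasurableSpace E] [BorelSpace E]

theorem lintegral_mul_gaussian_of_homogeneous [Nontrivial E] {φ : E → ENNReal}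
    (hφ : Measurable φ) (p : ℕ)
    (hhom : ∀ r : ℝ, 0 < r → ∀ x : E, φ (r • x) = ENNReal.ofReal (r ^ p) * φ x) :
    ∫⁻ x, φ x * ENNReal.ofReal (Real.exp (-‖x‖ ^ 2)) =
      (∫⁻ u : Metric.sphere (0 : E) 1, φ u ∂(volume : Measure E).toSphere) *
        ENNReal.ofReal (Real.Gamma (((finrank ℝ E : ℝ) + p) / 2) / 2) := by
  rw [lintegral_eq_lintegral_toSphere _ (by fun_prop), ← lintegral_mul_const _ (by fun_prop)]
  refine lintegral_congr fun u => ?_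
  have hradial := lintegral_Ioi_pow_mul_exp_neg_sq (finrank ℝ E - 1 + p)
  rw [← Nat.cast_add_one, show finrank ℝ E - 1 + p + 1 = finrank ℝ E + p by
    have : 0 < finrank ℝ E := finrank_pos
    omega, Nat.cast_add] at hradial
  rw [← hradial, ← lintegral_const_mul _ (by fun_prop)]
  refine setLIntegral_congr_fun measurableSet_Ioi fun r (hr : 0 < r) => ?_
  rw [hhom r hr, norm_smul, norm_eq_of_mem_sphere, mul_one, Real.norm_eq_abs, sq_abs, pow_add,
    ENNReal.ofReal_mul (by positivity)]
  ring

variable (E) in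
theorem lintegral_gaussian :
    ∫⁻ x : E, ENNReal.ofReal (Real.exp (-‖x‖ ^ 2)) =
      ENNReal.ofReal (Real.pi ^ ((finrank ℝ E : ℝ) / 2)) := by
  have h := GaussianFourier.integral_rexp_neg_mul_sq_norm (V := E) one_pos
  simp only [neg_mul, one_mul, div_one] at h
  have hint : Integrable fun x : E => Real.exp (-‖x‖ ^ 2) := by
    refine .of_integral_ne_zero ?_
    rw [h]
    exact (Real.rpow_pos_of_pos Real.pi_pos _).ne'
  rw [← h, ofReal_integral_eq_lintegral_ofReal hint (ae_of_all _ fun x => (Real.exp_pos _).le)]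

variable (E) in
theorem toSphere_univ_mul_gamma [Nontrivial E] :
    (volume : Measure E).toSphere univ * ENNReal.ofReal (Real.Gamma ((finrank ℝ E : ℝ) / 2) / 2) =
      ENNReal.ofReal (Real.pi ^ ((finrank ℝ E : ℝ) / 2)) := by
  have h := lintegral_mul_gaussian_of_homogeneous (E := E) (φ := fun _ => 1) measurable_const 0
    (by simp)
  simpa only [one_mul, lintegral_gaussian, lintegral_one, Nat.cast_zero, add_zero] using h.symm

theorem lintegral_orthogonalProjectionOnto_prodMk (K : Submodule ℝ E) {φ : K × Kᗮ → ENNReal}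
    (hφ : Measurable φ) :
    ∫⁻ x, φ (K.orthogonalProjectionOnto x, Kᗮ.orthogonalProjectionOnto x) =
      ∫⁻ y : K, ∫⁻ z : Kᗮ, φ (y, z) := by
  have hdecomp := (WithLp.volume_preserving_ofLp K Kᗮ).comp
    K.orthogonalDecomposition.measurePreserving
  have h := hdecomp.lintegral_comp hφ
  rw [Measure.volume_eq_prod, lintegral_prod _ hφ.aemeasurable] at h
  rw [← h]
  exact lintegral_congr fun x => by simp [Submodule.orthogonalDecomposition_apply]

theorem lintegral_comp_orthogonalProjectionOnto_mul_gaussian (K : Submodule ℝ E)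
    {φ : K → ENNReal} (hφ : Measurable φ) :
    ∫⁻ x, φ (K.orthogonalProjectionOnto x) * ENNReal.ofReal (Real.exp (-‖x‖ ^ 2)) =
      (∫⁻ y : K, φ y * ENNReal.ofReal (Real.exp (-‖y‖ ^ 2))) *
        ∫⁻ z : Kᗮ, ENNReal.ofReal (Real.exp (-‖z‖ ^ 2)) := by
  have h := lintegral_orthogonalProjectionOnto_prodMk K (φ := fun p : K × Kᗮ =>
    φ p.1 * ENNReal.ofReal (Real.exp (-‖p.1‖ ^ 2)) * ENNReal.ofReal (Real.exp (-‖p.2‖ ^ 2)))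
    (by fun_prop)
  simp only [lintegral_const_mul _
    (show Measurable fun z : Kᗮ => ENNReal.ofReal (Real.exp (-‖z‖ ^ 2)) by fun_prop)] at h
  rw [← lintegral_mul_const _ (by fun_prop), ← h]
  refine lintegral_congr fun x => ?_
  rw [mul_assoc, ← ENNReal.ofReal_mul (Real.exp_pos _).le, ← Real.exp_add,
    K.norm_sq_eq_add_norm_sq_projection x, neg_add]

/-- The `p`-th moment of the norm of the orthogonal projection to a `k`-dimensional subspace of a
uniformly distributed point of the unit sphere of an `n`-dimensional space. -/
def projectionMoment (p k n : ℕ) : ℝ :=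
  Real.Gamma (((k : ℝ) + p) / 2) * Real.Gamma ((n : ℝ) / 2) /
    (Real.Gamma ((k : ℝ) / 2) * Real.Gamma (((n : ℝ) + p) / 2))

theorem projectionMoment_pos (p : ℕ) {k n : ℕ} (hk : 0 < k) (hn : 0 < n) :
    0 < projectionMoment p k n :=
  div_pos (mul_pos (Real.Gamma_pos_of_pos (by positivity)) (Real.Gamma_pos_of_pos (by positivity)))
    (mul_pos (Real.Gamma_pos_of_pos (by positivity)) (Real.Gamma_pos_of_pos (by positivity)))

theorem lintegral_toSphere_norm_projection_pow_mul_gamma [Nontrivial E] (K : Submodule ℝ E)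
    [Nontrivial K] (p : ℕ) :
    (∫⁻ u : Metric.sphere (0 : E) 1, ENNReal.ofReal (‖K.orthogonalProjectionOnto (u : E)‖ ^ p)
        ∂(volume : Measure E).toSphere) *
          ENNReal.ofReal (Real.Gamma (((finrank ℝ E : ℝ) + p) / 2) / 2) =
      (volume : Measure K).toSphere univ *
        ENNReal.ofReal (Real.Gamma (((finrank ℝ K : ℝ) + p) / 2) / 2) *
          ∫⁻ z : Kᗮ, ENNReal.ofReal (Real.exp (-‖z‖ ^ 2)) := by
  have hhom {F : Type _} [NormedAddCommGroup F] [NormedSpace ℝ F] (r : ℝ) (hr : 0 < r) (y : F) :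
      ENNReal.ofReal (‖r • y‖ ^ p) = ENNReal.ofReal (r ^ p) * ENNReal.ofReal (‖y‖ ^ p) := by
    rw [norm_smul, Real.norm_of_nonneg hr.le, mul_pow, ENNReal.ofReal_mul (by positivity)]
  rw [← lintegral_mul_gaussian_of_homogeneous
      (φ := fun x => ENNReal.ofReal (‖K.orthogonalProjectionOnto x‖ ^ p)) (by fun_prop) p
      (fun r hr x => by rw [map_smul, hhom r hr]),
    lintegral_comp_orthogonalProjectionOnto_mul_gaussian K
      (φ := fun y => ENNReal.ofReal (‖y‖ ^ p)) (by fun_prop),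
    lintegral_mul_gaussian_of_homogeneous (E := K) (φ := fun y => ENNReal.ofReal (‖y‖ ^ p))
      (by fun_prop) p hhom]
  simp only [norm_eq_of_mem_sphere, one_pow, ENNReal.ofReal_one, lintegral_one]

theorem lintegral_toSphere_norm_projection_pow [Nontrivial E] (K : Submodule ℝ E) [Nontrivial K]
    (p : ℕ) :
    ∫⁻ u : Metric.sphere (0 : E) 1, ENNReal.ofReal (‖K.orthogonalProjectionOnto (u : E)‖ ^ p)
        ∂(volume : Measure E).toSphere =
      (volume : Measure E).toSphere univ *
        ENNReal.ofReal (projectionMoment p (finrank ℝ K) (finrank ℝ E)) := by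
  have hE : 0 < finrank ℝ E := finrank_pos
  have hK : 0 < finrank ℝ K := finrank_pos
  have hmoment := lintegral_toSphere_norm_projection_pow_mul_gamma K p
  have hmass := lintegral_toSphere_norm_projection_pow_mul_gamma K 0
  simp only [pow_zero, ENNReal.ofReal_one, lintegral_one, Nat.cast_zero, add_zero] at hmass
  have hΓK : 0 < Real.Gamma ((finrank ℝ K : ℝ) / 2) := Real.Gamma_pos_of_pos (by positivity)
  have hΓE : 0 < Real.Gamma (((finrank ℝ E : ℝ) + p) / 2) := Real.Gamma_pos_of_pos (by positivity)
  set a := Real.Gamma ((finrank ℝ K : ℝ) / 2)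
  set b := Real.Gamma (((finrank ℝ E : ℝ) + p) / 2)
  have hcancel : ENNReal.ofReal (projectionMoment p (finrank ℝ K) (finrank ℝ E)) *
      (ENNReal.ofReal (b / 2) * ENNReal.ofReal (a / 2)) =
      ENNReal.ofReal (Real.Gamma ((finrank ℝ E : ℝ) / 2) / 2) *
        ENNReal.ofReal (Real.Gamma (((finrank ℝ K : ℝ) + p) / 2) / 2) := by
    rw [← ENNReal.ofReal_mul (by positivity),
      ← ENNReal.ofReal_mul (projectionMoment_pos p hK hE).le, ← ENNReal.ofReal_mul
        (half_pos (Real.Gamma_pos_of_pos (by positivity))).le, projectionMoment]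
    congr 1
    field_simp
    exact mul_comm _ _
  refine (ENNReal.mul_left_inj (c := ENNReal.ofReal (b / 2) * ENNReal.ofReal (a / 2))
    (by simp [hΓK, hΓE]) (by finiteness)).1 ?_
  rw [mul_assoc _ (ENNReal.ofReal (projectionMoment _ _ _)), hcancel, ← mul_assoc, ← mul_assoc,
    hmoment, hmass]
  ring

theorem toSphere_univ_of_finrank_eq_add_one {F : Type*} [NormedAddCommGroup F]
    [InnerProductSpace ℝ F] [FiniteDimensional ℝ F] [MeasurableSpace F] [BorelSpace F]
    [Nontrivial E] [Nontrivial F] (h : finrank ℝ E = finrank ℝ F + 1) :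
    (volume : Measure F).toSphere univ =
      (volume : Measure E).toSphere univ * ENNReal.ofReal (cosConst (finrank ℝ E)) := by
  have hF : 0 < finrank ℝ F := finrank_pos
  have hΓF : 0 < Real.Gamma ((finrank ℝ F : ℝ) / 2) := Real.Gamma_pos_of_pos (by positivity)
  have hareaF := toSphere_univ_mul_gamma F
  have hareaE := toSphere_univ_mul_gamma E
  rw [h, Nat.cast_add_one, add_div, Real.rpow_add Real.pi_pos, ← Real.sqrt_eq_rpow,
    ENNReal.ofReal_mul (by positivity), ← hareaF, ← add_div] at hareaE
  have hcancel : ENNReal.ofReal (cosConst (finrank ℝ E)) *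
      (ENNReal.ofReal (Real.Gamma ((finrank ℝ F : ℝ) / 2) / 2) * ENNReal.ofReal √Real.pi) =
      ENNReal.ofReal (Real.Gamma (((finrank ℝ F : ℝ) + 1) / 2) / 2) := by
    rw [← ENNReal.ofReal_mul (by positivity), ← ENNReal.ofReal_mul' (by positivity), cosConst, h,
      Nat.cast_add_one, add_sub_cancel_right]
    congr 1
    field_simp
  refine (ENNReal.mul_left_inj (c := ENNReal.ofReal (Real.Gamma ((finrank ℝ F : ℝ) / 2) / 2) *
    ENNReal.ofReal √Real.pi) (by simp [hΓF, Real.pi_pos]) (by finiteness)).1 ?_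
  rw [mul_assoc _ (ENNReal.ofReal (cosConst _)), hcancel, hareaE, mul_assoc]

theorem lintegral_eq_cylindrical {x : E} (hx : ‖x‖ = 1)
    [Nontrivial (ℝ ∙ x)ᗮ] {ψ : ℝ × ℝ → ENNReal} (hψ : Measurable ψ) :
    ∫⁻ v : E, ψ (inner ℝ x v, ‖(ℝ ∙ x)ᗮ.orthogonalProjectionOnto v‖) =
      (∫⁻ t : ℝ, ∫⁻ r in Ioi (0 : ℝ), ENNReal.ofReal (r ^ (finrank ℝ E - 2)) * ψ (t, r)) *
        (volume : Measure (ℝ ∙ x)ᗮ).toSphere univ := by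
  have hx0 : x ≠ 0 := norm_ne_zero_iff.1 (by simp [hx])
  have hradial (t : ℝ) : ∫⁻ z : (ℝ ∙ x)ᗮ, ψ (t, ‖z‖) =
      (∫⁻ r in Ioi (0 : ℝ), ENNReal.ofReal (r ^ (finrank ℝ E - 2)) * ψ (t, r)) *
        (volume : Measure (ℝ ∙ x)ᗮ).toSphere univ := by
    rw [lintegral_eq_lintegral_toSphere _ (by fun_prop), ← lintegral_const,
      ← finrank_orthogonal_span_singleton_add_one hx0]
    refine lintegral_congr fun u => setLIntegral_congr_fun measurableSet_Ioi
      fun r (hr : 0 < r) => ?_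
    simp [norm_smul, abs_of_pos hr]
  let axis : ℝ ≃ₗᵢ[ℝ] ℝ ∙ x := LinearIsometryEquiv.toSpanUnitSingleton x hx
  have haxis (t : ℝ) : inner ℝ x (axis t : E) = t := by
    simp [axis, LinearIsometryEquiv.toSpanUnitSingleton_apply, inner_smul_right, hx]
  have hinner (v : E) : inner ℝ x ((ℝ ∙ x).orthogonalProjectionOnto v : E) = inner ℝ x v :=
    (ℝ ∙ x).inner_orthogonalProjectionOnto_eq_of_mem_left ⟨x, Submodule.mem_span_singleton_self x⟩ v
  have hmeas : Measurable fun t : ℝ => ∫⁻ r in Ioi (0 : ℝ),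
      ENNReal.ofReal (r ^ (finrank ℝ E - 2)) * ψ (t, r) :=
    Measurable.lintegral_prod_right'
      (f := fun p : ℝ × ℝ => ENNReal.ofReal (p.2 ^ (finrank ℝ E - 2)) * ψ p) (by fun_prop)
  calc ∫⁻ v : E, ψ (inner ℝ x v, ‖(ℝ ∙ x)ᗮ.orthogonalProjectionOnto v‖)
      = ∫⁻ y : ℝ ∙ x, ∫⁻ z : (ℝ ∙ x)ᗮ, ψ (inner ℝ x (y : E), ‖z‖) := by
        rw [← lintegral_orthogonalProjectionOnto_prodMk (ℝ ∙ x)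
          (φ := fun p => ψ (inner ℝ x (p.1 : E), ‖p.2‖)) (by fun_prop)]
        simp only [hinner]
    _ = ∫⁻ t : ℝ, ∫⁻ z : (ℝ ∙ x)ᗮ, ψ (t, ‖z‖) := by
        rw [← axis.measurePreserving.lintegral_comp_emb axis.toHomeomorph.measurableEmbedding]
        simp only [haxis]
    _ = _ := by
        rw [lintegral_congr hradial, lintegral_mul_const _ hmeas]

theorem lintegral_toSphere_comp_inner_mul_gamma (hE : 2 ≤ finrank ℝ E) {x : E} (hx : ‖x‖ = 1)
    {g : ℝ → ENNReal} (hg : Measurable g) :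
    (∫⁻ u : Metric.sphere (0 : E) 1, g (inner ℝ x (u : E)) ∂(volume : Measure E).toSphere) *
        ENNReal.ofReal (Real.Gamma ((finrank ℝ E : ℝ) / 2) / 2) =
      (∫⁻ y in Icc (-1 : ℝ) 1, ENNReal.ofReal ((1 - y ^ 2) ^ (((finrank ℝ E : ℝ) - 3) / 2)) * g y) *
        ENNReal.ofReal (Real.Gamma ((finrank ℝ E : ℝ) / 2) / 2) *
          (volume : Measure (ℝ ∙ x)ᗮ).toSphere univ := by
  have hx0 : x ≠ 0 := norm_ne_zero_iff.1 (by simp [hx])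
  have : Nontrivial E := nontrivial_of_ne x 0 hx0
  have : Nontrivial (ℝ ∙ x)ᗮ := nontrivial_orthogonal_span_singleton hE hx0
  have hhom (r : ℝ) (hr : 0 < r) (v : E) :
      g (inner ℝ x (r • v) / ‖r • v‖) = ENNReal.ofReal (r ^ 0) * g (inner ℝ x v / ‖v‖) := by
    rw [norm_smul, Real.norm_of_nonneg hr.le, inner_smul_right, mul_div_mul_left _ _ hr.ne',
      pow_zero, ENNReal.ofReal_one, one_mul]
  have hnorm (v : E) :
      ‖v‖ ^ 2 = inner ℝ x v ^ 2 + ‖(ℝ ∙ x)ᗮ.orthogonalProjectionOnto v‖ ^ 2 := by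
    rw [(ℝ ∙ x).norm_sq_eq_add_norm_sq_projection v, Submodule.coe_norm,
      ← Submodule.starProjection_apply, Submodule.starProjection_unit_singleton ℝ hx, norm_smul, hx,
      mul_one, Real.norm_eq_abs, sq_abs]
  have hgauss := lintegral_mul_gaussian_of_homogeneous (φ := fun v => g (inner ℝ x v / ‖v‖))
    (by fun_prop) 0 hhom
  simp only [norm_eq_of_mem_sphere, div_one, Nat.cast_zero, add_zero] at hgauss
  have hplane := lintegral_upperHalfPlane_gaussian (finrank ℝ E - 2) hg
  rw [Nat.cast_sub hE, Nat.cast_ofNat, sub_add_cancel, sub_sub,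
    show (2 : ℝ) + 1 = 3 by norm_num] at hplane
  rw [← hgauss, setLIntegral_congr Ioo_ae_eq_Icc.symm, ← hplane,
    ← lintegral_eq_cylindrical hx (ψ := fun p => g (p.1 / √(p.1 ^ 2 + p.2 ^ 2)) *
      ENNReal.ofReal (Real.exp (-(p.1 ^ 2 + p.2 ^ 2)))) (by fun_prop)]
  refine lintegral_congr fun v => ?_
  rw [← hnorm, Real.sqrt_sq (norm_nonneg v)]

theorem lintegral_toSphere_comp_inner (hE : 2 ≤ finrank ℝ E) {x : E} (hx : ‖x‖ = 1)
    {g : ℝ → ENNReal} (hg : Measurable g) :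
    ∫⁻ u : Metric.sphere (0 : E) 1, g (inner ℝ x (u : E)) ∂(volume : Measure E).toSphere =
      (volume : Measure E).toSphere univ *
        ∫⁻ y in Icc (-1 : ℝ) 1, ENNReal.ofReal (cosDensity (finrank ℝ E) y) * g y := by
  have hx0 : x ≠ 0 := norm_ne_zero_iff.1 (by simp [hx])
  have : Nontrivial E := nontrivial_of_ne x 0 hx0
  have : Nontrivial (ℝ ∙ x)ᗮ := nontrivial_orthogonal_span_singleton hE hx0
  have hΓ : 0 < Real.Gamma ((finrank ℝ E : ℝ) / 2) := Real.Gamma_pos_of_pos (by positivity)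
  have hdensity : ∫⁻ y in Icc (-1 : ℝ) 1, ENNReal.ofReal (cosDensity (finrank ℝ E) y) * g y =
      ENNReal.ofReal (cosConst (finrank ℝ E)) * ∫⁻ y in Icc (-1 : ℝ) 1,
        ENNReal.ofReal ((1 - y ^ 2) ^ (((finrank ℝ E : ℝ) - 3) / 2)) * g y := by
    rw [← lintegral_const_mul _ (by fun_prop)]
    refine setLIntegral_congr_fun measurableSet_Icc fun y hy => ?_
    rw [cosDensity, ENNReal.ofReal_mul' (Real.rpow_nonneg (by nlinarith [hy.1, hy.2]) _), mul_assoc]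
  refine (ENNReal.mul_left_inj (c := ENNReal.ofReal (Real.Gamma ((finrank ℝ E : ℝ) / 2) / 2))
    (by simp [hΓ]) (by finiteness)).1 ?_
  rw [lintegral_toSphere_comp_inner_mul_gamma hE hx hg, hdensity,
    toSphere_univ_of_finrank_eq_add_one (finrank_orthogonal_span_singleton_add_one hx0).symm]
  ring

end Sphere

section Law

instance isProbabilityMeasure_sphereUniform {ι : Type*} [Fintype ι] [Nonempty ι] :
    IsProbabilityMeasure (sphereUniform ι) :=
  have : NeZero (volume : Measure (EuclideanSpace ℝ ι)).toSphere :=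
    ⟨Measure.toSphere_ne_zero _⟩
  isProbabilityMeasureSMul

theorem lintegral_sphereUniform_eq_of_toSphere {ι : Type*} [Fintype ι] [Nonempty ι]
    {φ : USphere ι → ENNReal} {c : ENNReal}
    (h : ∫⁻ u, φ u ∂(volume : Measure (EuclideanSpace ℝ ι)).toSphere =
      (volume : Measure (EuclideanSpace ℝ ι)).toSphere univ * c) :
    ∫⁻ u, φ u ∂sphereUniform ι = c := by
  rw [sphereUniform, lintegral_smul_measure, h, smul_eq_mul, ENNReal.inv_mul_cancel_left
    (Measure.measure_univ_ne_zero.2 (Measure.toSphere_ne_zero _)) (measure_ne_top _ _)]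

theorem abs_inner_uSphere_le_one {ι : Type*} [Fintype ι] (x u : USphere ι) :
    |inner ℝ (x : EuclideanSpace ℝ ι) u| ≤ 1 := by
  simpa using abs_real_inner_le_norm (x : EuclideanSpace ℝ ι) u

variable {n : ℕ}

theorem cosConst_pos (hn : 2 ≤ n) : 0 < cosConst n := by
  have h : (2 : ℝ) ≤ n := by exact_mod_cast hn
  exact div_pos (Real.Gamma_pos_of_pos (by linarith))
    (mul_pos (Real.sqrt_pos.2 Real.pi_pos) (Real.Gamma_pos_of_pos (by linarith)))

theorem cosDensity_nonneg (hn : 2 ≤ n) {y : ℝ} (hy : y ∈ Icc (-1 : ℝ) 1) :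
    0 ≤ cosDensity n y :=
  mul_nonneg (cosConst_pos hn).le (Real.rpow_nonneg (by nlinarith [hy.1, hy.2]) _)

theorem cosDensity_pos (hn : 2 ≤ n) {y : ℝ} (hy : y ∈ Ioo (-1 : ℝ) 1) : 0 < cosDensity n y :=
  mul_pos (cosConst_pos hn) (Real.rpow_pos_of_pos (by nlinarith [hy.1, hy.2]) _)

variable (n) in
theorem measurable_cosDensity : Measurable (cosDensity n) := by
  unfold cosDensity
  fun_prop

theorem continuousAt_cosDensity {y : ℝ} (hy : y ∈ Ioo (-1 : ℝ) 1) :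
    ContinuousAt (cosDensity n) y := by
  have hpos : 0 < 1 - y ^ 2 := by nlinarith [hy.1, hy.2]
  exact continuousAt_const.mul (ContinuousAt.rpow_const (by fun_prop) (.inl hpos.ne'))

theorem lintegral_sphereUniform_comp_inner (hn : 2 ≤ n) (x : USphere (Fin n)) {g : ℝ → ENNReal}
    (hg : Measurable g) :
    ∫⁻ u : USphere (Fin n), g (inner ℝ (x : EuclideanSpace ℝ (Fin n)) u) ∂sphereUniform (Fin n) =
      ∫⁻ y in Icc (-1 : ℝ) 1, ENNReal.ofReal (cosDensity n y) * g y := by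
  have : NeZero n := ⟨by omega⟩
  have h := lintegral_toSphere_comp_inner (by simpa using hn) (norm_eq_of_mem_sphere x) hg
  rw [finrank_euclideanSpace_fin] at h
  exact lintegral_sphereUniform_eq_of_toSphere h

theorem map_inner_sphereUniform (hn : 2 ≤ n) (x : USphere (Fin n)) :
    (sphereUniform (Fin n)).map
        (fun u : USphere (Fin n) => inner ℝ (x : EuclideanSpace ℝ (Fin n)) u) =
      (volume.restrict (Icc (-1 : ℝ) 1)).withDensity
        (fun y => ENNReal.ofReal (cosDensity n y)) := by
  refine Measure.ext_of_lintegral _ fun g hg => ?_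
  rw [lintegral_map hg (by fun_prop), lintegral_sphereUniform_comp_inner hn x hg,
    lintegral_withDensity_eq_lintegral_mul _ (measurable_cosDensity n).ennreal_ofReal hg]
  rfl

theorem nonempty_uSphere (hn : 2 ≤ n) : Nonempty (USphere (Fin n)) :=
  have : NeZero n := ⟨by omega⟩
  nonempty_of_isProbabilityMeasure (sphereUniform (Fin n))

theorem integrableOn_cosDensity (hn : 2 ≤ n) : IntegrableOn (cosDensity n) (Icc (-1) 1) := by
  have : NeZero n := ⟨by omega⟩
  obtain ⟨x⟩ := nonempty_uSphere hn
  have hmass := lintegral_sphereUniform_comp_inner hn x (g := fun _ => 1) measurable_const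
  simp only [mul_one, lintegral_one, measure_univ] at hmass
  refine (lintegral_ofReal_ne_top_iff_integrable (measurable_cosDensity n).aestronglyMeasurable
    ?_).1 (hmass ▸ ENNReal.one_ne_top)
  filter_upwards [ae_restrict_mem measurableSet_Icc] with y hy using cosDensity_nonneg hn hy

theorem intervalIntegrable_cosDensity (hn : 2 ≤ n) {y : ℝ} (hy : y ∈ Icc (-1 : ℝ) 1) :
    IntervalIntegrable (cosDensity n) volume (-1) y :=
  (intervalIntegrable_iff_integrableOn_Icc_of_le hy.1).2
    ((integrableOn_cosDensity hn).mono_set (Icc_subset_Icc_right hy.2))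

theorem sphereUniform_real_inner_le (hn : 2 ≤ n) (x : USphere (Fin n)) {y : ℝ}
    (hy : y ∈ Icc (-1 : ℝ) 1) :
    (sphereUniform (Fin n)).real
        {u : USphere (Fin n) | inner ℝ (x : EuclideanSpace ℝ (Fin n)) u ≤ y} = cosCDF n y := by
  have hlaw : sphereUniform (Fin n) {u | inner ℝ (x : EuclideanSpace ℝ (Fin n)) u ≤ y} =
      ∫⁻ t in Ioc (-1) y, ENNReal.ofReal (cosDensity n t) := by
    change sphereUniform (Fin n) ((fun u : USphere (Fin n) =>
      inner ℝ (x : EuclideanSpace ℝ (Fin n)) u) ⁻¹' Iic y) = _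
    rw [← Measure.map_apply (by fun_prop) measurableSet_Iic, map_inner_sphereUniform hn,
      withDensity_apply _ measurableSet_Iic, Measure.restrict_restrict measurableSet_Iic,
      inter_comm, ← Ici_inter_Iic, inter_assoc, Iic_inter_Iic, min_eq_right hy.2, Ici_inter_Iic,
      setLIntegral_congr Ioc_ae_eq_Icc.symm]
  rw [measureReal_def, hlaw, cosCDF, intervalIntegral.integral_of_le hy.1,
    integral_eq_lintegral_of_nonneg_ae _ (measurable_cosDensity n).aestronglyMeasurable]
  filter_upwards [ae_restrict_mem measurableSet_Ioc] with t ht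
  exact cosDensity_nonneg hn ⟨ht.1.le, ht.2.trans hy.2⟩

variable (n) in
theorem cosCDF_neg_one : cosCDF n (-1) = 0 :=
  intervalIntegral.integral_same

theorem cosCDF_one (hn : 2 ≤ n) : cosCDF n 1 = 1 := by
  have : NeZero n := ⟨by omega⟩
  obtain ⟨x⟩ := nonempty_uSphere hn
  have huniv : {u : USphere (Fin n) | inner ℝ (x : EuclideanSpace ℝ (Fin n)) u ≤ 1} = univ :=
    eq_univ_of_forall fun u => (abs_le.1 (abs_inner_uSphere_le_one x u)).2
  rw [← sphereUniform_real_inner_le hn x (by norm_num), huniv, probReal_univ]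

theorem cosCDF_pos (hn : 2 ≤ n) {y : ℝ} (hy : y ∈ Ioc (-1 : ℝ) 1) : 0 < cosCDF n y :=
  intervalIntegral.intervalIntegral_pos_of_pos_on
    (intervalIntegrable_cosDensity hn (Ioc_subset_Icc_self hy))
    (fun _ ht => cosDensity_pos hn ⟨ht.1, ht.2.trans_le hy.2⟩) hy.1

theorem continuousOn_cosCDF (hn : 2 ≤ n) : ContinuousOn (cosCDF n) (Icc (-1) 1) := by
  rw [← uIcc_of_le (by norm_num)]
  exact intervalIntegral.continuousOn_primitive_interval
    (by simpa only [uIcc_of_le (show (-1 : ℝ) ≤ 1 by norm_num)] using integrableOn_cosDensity hn)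

theorem hasDerivAt_cosCDF (hn : 2 ≤ n) {y : ℝ} (hy : y ∈ Ioo (-1 : ℝ) 1) :
    HasDerivAt (cosCDF n) (cosDensity n y) y :=
  intervalIntegral.integral_hasDerivAt_right
    (intervalIntegrable_cosDensity hn (Ioo_subset_Icc_self hy))
    (measurable_cosDensity n).stronglyMeasurable.stronglyMeasurableAtFilter
    (continuousAt_cosDensity hy)

theorem natCast_mul_integral_mul_cosCDF_pow (hn : 2 ≤ n) {m : ℕ} (hm : m ≠ 0) :
    (m : ℝ) * ∫ y in (-1 : ℝ)..1, y * cosCDF n y ^ (m - 1) * cosDensity n y =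
      1 - ∫ y in (-1 : ℝ)..1, cosCDF n y ^ m := by
  have hIcc : uIcc (-1 : ℝ) 1 = Icc (-1) 1 := uIcc_of_le (by norm_num)
  have hIoo : Ioo (min (-1 : ℝ) 1) (max (-1) 1) = Ioo (-1) 1 := by norm_num
  have hderiv_integrable : IntervalIntegrable
      (fun y => m * cosCDF n y ^ (m - 1) * cosDensity n y) volume (-1) 1 := by
    refine (intervalIntegrable_cosDensity hn (by norm_num)).continuousOn_mul ?_
    rw [hIcc]
    exact continuousOn_const.mul ((continuousOn_cosCDF hn).pow _)
  have hparts := intervalIntegral.integral_mul_deriv_eq_deriv_mul_of_hasDerivAt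
    (u := fun y => y) (v := fun y => cosCDF n y ^ m) (u' := fun _ => 1) continuousOn_id
    (hIcc ▸ (continuousOn_cosCDF hn).pow m) (fun y _ => hasDerivAt_id y)
    (fun y hy => (hasDerivAt_cosCDF hn (hIoo ▸ hy)).pow m) intervalIntegrable_const
    hderiv_integrable
  simp only [cosCDF_one hn, cosCDF_neg_one, one_pow, one_mul, zero_pow hm, mul_zero,
    sub_zero] at hparts
  rw [← hparts, ← intervalIntegral.integral_const_mul]
  refine intervalIntegral.integral_congr fun y _ => ?_
  ring

end Law

section Maximum

variable {Ω : Type*} [MeasurableSpace Ω] {μ : Measure Ω} [IsProbabilityMeasure μ] {X : Ω → ℝ}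

theorem integral_eq_one_sub_integral_measureReal_le (hX : Measurable X) (hb : ∀ ω, |X ω| ≤ 1) :
    ∫ ω, X ω ∂μ = 1 - ∫ y in (-1 : ℝ)..1, μ.real {ω | X ω ≤ y} := by
  have hint : Integrable X μ := .of_bound hX.aestronglyMeasurable 1 (ae_of_all _ hb)
  have htail (t : ℝ) : {ω | t ≤ 1 - X ω} = {ω | X ω ≤ 1 - t} := by
    simp only [le_sub_comm]
  have hlayer := ((integrable_const (1 : ℝ)).sub hint).integral_eq_integral_Ioc_meas_le (M := 2)
    (ae_of_all _ fun ω => show 0 ≤ 1 - X ω by linarith [(abs_le.1 (hb ω)).2])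
    (ae_of_all _ fun ω => show 1 - X ω ≤ 2 by linarith [(abs_le.1 (hb ω)).1])
  have hreflect := intervalIntegral.integral_comp_sub_left (a := 0) (b := 2)
    (fun y => μ.real {ω | X ω ≤ y}) 1
  rw [show (1 : ℝ) - 2 = -1 by norm_num, sub_zero] at hreflect
  simp only [Pi.sub_apply, htail] at hlayer
  rw [integral_sub (integrable_const _) hint, integral_const, probReal_univ, one_smul,
    ← intervalIntegral.integral_of_le zero_le_two, hreflect] at hlayer
  linarith

theorem integral_sup'_pi {ι : Type*} [Fintype ι] [Nonempty ι] (hX : Measurable X)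
    (hb : ∀ ω, |X ω| ≤ 1) :
    ∫ ω : ι → Ω, Finset.univ.sup' Finset.univ_nonempty (fun i => X (ω i))
        ∂(Measure.pi fun _ => μ) =
      1 - ∫ y in (-1 : ℝ)..1, μ.real {ω | X ω ≤ y} ^ Fintype.card ι := by
  have hmeas : Measurable fun ω : ι → Ω =>
      Finset.univ.sup' Finset.univ_nonempty (fun i => X (ω i)) := by fun_prop
  have hbound (ω : ι → Ω) :
      |Finset.univ.sup' Finset.univ_nonempty (fun i => X (ω i))| ≤ 1 := by
    obtain ⟨i, -, hi⟩ := Finset.exists_mem_eq_sup' Finset.univ_nonempty (fun i => X (ω i))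
    exact hi ▸ hb (ω i)
  rw [integral_eq_one_sub_integral_measureReal_le hmeas hbound]
  congr 1
  refine intervalIntegral.integral_congr fun y _ => ?_
  have hpi : {ω : ι → Ω | Finset.univ.sup' Finset.univ_nonempty (fun i => X (ω i)) ≤ y} =
      univ.pi fun _ => {ω | X ω ≤ y} := by
    ext ω
    simp
  simp only [hpi, measureReal_def, Measure.pi_pi, Finset.prod_const, Finset.card_univ,
    ENNReal.toReal_pow]

theorem measureReal_abs_le_le_sq (hX : Measurable X)
    (hsymm : ProbabilityTheory.IdentDistrib (fun ω => -X ω) X μ μ) (y : ℝ) :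
    μ.real {ω | |X ω| ≤ y} ≤ μ.real {ω | X ω ≤ y} ^ 2 := by
  rcases lt_or_ge y 0 with hy | hy
  · have hempty : {ω | |X ω| ≤ y} = ∅ :=
      eq_empty_of_forall_notMem fun ω hω => (hω.trans_lt hy).not_ge (abs_nonneg _)
    rw [hempty, measureReal_empty]
    positivity
  · have hinter : {ω | |X ω| ≤ y} = {ω | X ω ≤ y} ∩ {ω | -X ω ≤ y} := by
      ext ω
      exact abs_le' (a := X ω)
    have hunion : {ω | X ω ≤ y} ∪ {ω | -X ω ≤ y} = univ := by
      refine eq_univ_of_forall fun ω => (le_total (X ω) 0).imp (fun h => h.trans hy) fun h => ?_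
      exact (neg_nonpos.2 h : -X ω ≤ 0).trans hy
    have hneg : μ.real {ω | -X ω ≤ y} = μ.real {ω | X ω ≤ y} :=
      congrArg ENNReal.toReal (hsymm.measure_mem_eq measurableSet_Iic)
    have h := measureReal_union_add_inter (μ := μ) (s := {ω | X ω ≤ y})
      (measurableSet_le hX.neg measurable_const : MeasurableSet {ω | -X ω ≤ y})
    rw [hunion, probReal_univ, ← hinter, hneg] at h
    nlinarith [sq_nonneg (μ.real {ω | X ω ≤ y} - 1)]

theorem integral_measureReal_abs_le_pow_lt (hX : Measurable X)
    (hsymm : ProbabilityTheory.IdentDistrib (fun ω => -X ω) X μ μ)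
    (hpos : ∀ y ∈ Ioo (-1 : ℝ) 0, 0 < μ.real {ω | X ω ≤ y}) {k : ℕ} (hk : k ≠ 0) :
    ∫ y in (-1 : ℝ)..1, μ.real {ω | |X ω| ≤ y} ^ k <
      ∫ y in (-1 : ℝ)..1, μ.real {ω | X ω ≤ y} ^ (2 * k) := by
  have hmono (Y : Ω → ℝ) (p : ℕ) :
      IntervalIntegrable (fun y => μ.real {ω | Y ω ≤ y} ^ p) volume (-1) 1 := by
    refine Monotone.intervalIntegrable fun a b hab => ?_
    exact pow_le_pow_left₀ measureReal_nonneg (measureReal_mono fun ω hω => hω.trans hab) p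
  refine intervalIntegral.integral_lt_integral_of_ae_le_of_measure_setOfPred_lt_ne_zero
    (by norm_num) (hmono (fun ω => |X ω|) k) (hmono X (2 * k)) (ae_of_all _ fun y => ?_) ?_
  · simp only [pow_mul]
    exact pow_le_pow_left₀ measureReal_nonneg (measureReal_abs_le_le_sq hX hsymm y) k
  · have hstrict : Ioo (-1 : ℝ) 0 ⊆
        {y | μ.real {ω | |X ω| ≤ y} ^ k < μ.real {ω | X ω ≤ y} ^ (2 * k)} := fun y hy => by
      have hempty : {ω | |X ω| ≤ y} = ∅ :=
        eq_empty_of_forall_notMem fun ω hω => (hω.trans_lt hy.2).not_ge (abs_nonneg _)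
      rw [mem_ofPred_eq, hempty, measureReal_empty, zero_pow hk]
      exact pow_pos (hpos y hy) _
    have hsub : Ioo (-1 : ℝ) 0 ⊆ Ioc (-1) 1 := fun y hy => ⟨hy.1, hy.2.le.trans zero_le_one⟩
    refine ne_of_gt (lt_of_lt_of_le ?_ (measure_mono hstrict))
    rw [Measure.restrict_apply measurableSet_Ioo, inter_eq_left.2 hsub, Real.volume_Ioo]
    norm_num

end Maximum

section MaxInner

variable {E κ : Type*} [NormedAddCommGroup E] [InnerProductSpace ℝ E] [Fintype κ] [Nonempty κ]

/-- The largest inner product `max_i ⟨S i, y⟩` of `y` with a member of the finite family `S`. This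
is `A_S(y)` without the choice of a maximizer, so that measurability and homogeneity in `y` can be
read off. -/
def maxInner (S : κ → E) (y : E) : ℝ :=
  Finset.univ.sup' Finset.univ_nonempty fun i => inner ℝ (S i) y

theorem refCos_eq_maxInner (S : κ → E) (v : E) : refCos S v = maxInner S v := by
  have h : ∃ i, ∀ j, inner ℝ (S j) v ≤ inner ℝ (S i) v :=
    Finite.exists_max fun i => inner ℝ (S i) v
  rw [refCos, refVector, dif_pos h, real_inner_comm]
  exact le_antisymm (Finset.le_sup' (fun i => inner ℝ (S i) v) (Finset.mem_univ _))
    (Finset.sup'_le _ _ fun j _ => h.choose_spec j)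

theorem exists_maxInner_eq (S : κ → E) (y : E) : ∃ i, maxInner S y = inner ℝ (S i) y := by
  obtain ⟨i, -, hi⟩ :=
    Finset.exists_mem_eq_sup' Finset.univ_nonempty fun i => inner ℝ (S i) y
  exact ⟨i, hi⟩

theorem inner_le_maxInner (S : κ → E) (y : E) (i : κ) : inner ℝ (S i) y ≤ maxInner S y :=
  Finset.le_sup' (fun i => inner ℝ (S i) y) (Finset.mem_univ i)

theorem maxInner_smul (S : κ → E) (y : E) {r : ℝ} (hr : 0 ≤ r) :
    maxInner S (r • y) = r * maxInner S y := by
  simp only [maxInner, inner_smul_right]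
  exact (Finset.mul₀_sup' hr _ _ _).symm

theorem abs_maxInner_le {S : κ → E} (hS : ∀ i, ‖S i‖ = 1) (y : E) : |maxInner S y| ≤ ‖y‖ := by
  obtain ⟨i, hi⟩ := exists_maxInner_eq S y
  simpa only [hi, hS i, one_mul] using abs_real_inner_le_norm (S i) y

variable {Ω : Type*} [MeasurableSpace Ω]

theorem measurable_maxInner [MeasurableSpace E] [OpensMeasurableSpace E]
    [SecondCountableTopology E] {S : Ω → κ → E} {y : Ω → E} (hS : ∀ i, Measurable fun ω => S ω i)
    (hy : Measurable y) : Measurable fun ω => maxInner (S ω) (y ω) := by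
  unfold maxInner
  fun_prop

theorem integral_maxInner_eq_norm_mul {P : Measure Ω} {S : Ω → κ → E} {M : ℝ}
    (hM : ∀ x : E, ‖x‖ = 1 → ∫ ω, maxInner (S ω) x ∂P = M) (y : E) :
    ∫ ω, maxInner (S ω) y ∂P = ‖y‖ * M := by
  rcases eq_or_ne y 0 with rfl | hy
  · simp [maxInner]
  · rw [← hM (‖y‖⁻¹ • y) (by simp [norm_smul, hy]), ← integral_const_mul]
    simp only [← maxInner_smul _ _ (norm_nonneg y), smul_inv_smul₀ (norm_ne_zero_iff.2 hy)]

end MaxInner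

section Configuration

variable {L n : ℕ}

/-- The component at level `l` of a vector of `(ℝ^n)^L`, whose coordinates are indexed by pairs
(level, coordinate within the level) as in `multiLevel`. -/
def block (l : Fin L) (v : EuclideanSpace ℝ (Fin L × Fin n)) : EuclideanSpace ℝ (Fin n) :=
  WithLp.toLp 2 fun j => v (l, j)

/-- The isometric inclusion of `ℝ^n` as the component at level `l` of `(ℝ^n)^L`: its range is the
`n`-dimensional subspace to which `block l` is the orthogonal projection. -/
def blockIncl (l : Fin L) : EuclideanSpace ℝ (Fin n) →ₗᵢ[ℝ] EuclideanSpace ℝ (Fin L × Fin n) where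
  toFun y := WithLp.toLp 2 fun p => if p.1 = l then y p.2 else 0
  map_add' x y := by
    ext p
    by_cases h : p.1 = l <;> simp [h]
  map_smul' r x := by
    ext p
    by_cases h : p.1 = l <;> simp [h]
  norm_map' x := by
    simp [EuclideanSpace.norm_eq, Fintype.sum_prod_type_right, apply_ite (fun t : ℝ => |t|),
      ite_pow]

theorem blockIncl_apply (l : Fin L) (y : EuclideanSpace ℝ (Fin n)) (p : Fin L × Fin n) :
    blockIncl l y p = if p.1 = l then y p.2 else 0 := rfl

theorem norm_projection_range_blockIncl (l : Fin L) (v : EuclideanSpace ℝ (Fin L × Fin n)) :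
    ‖(LinearMap.range (blockIncl (n := n) l).toLinearMap).orthogonalProjectionOnto v‖ =
      ‖block l v‖ := by
  have hproj : (LinearMap.range (blockIncl (n := n) l).toLinearMap).starProjection v =
      blockIncl l (block l v) := by
    refine Submodule.eq_starProjection_of_mem_of_inner_eq_zero ⟨block l v, rfl⟩ ?_
    rintro _ ⟨z, rfl⟩
    simp [PiLp.inner_apply, Fintype.sum_prod_type_right, blockIncl_apply, block]
  have hnorm := congrArg norm hproj
  rwa [LinearIsometry.norm_map] at hnorm

theorem norm_block_le (l : Fin L) (v : EuclideanSpace ℝ (Fin L × Fin n)) :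
    ‖block l v‖ ≤ ‖v‖ :=
  norm_projection_range_blockIncl l v ▸ Submodule.norm_orthogonalProjectionOnto_apply_le _ v

@[fun_prop]
theorem measurable_block (l : Fin L) : Measurable (block (n := n) l) := by
  unfold block
  fun_prop

theorem integral_norm_block [NeZero n] (l : Fin L) :
    ∫ v : USphere (Fin L × Fin n), ‖block l (v : EuclideanSpace ℝ (Fin L × Fin n))‖
      ∂sphereUniform (Fin L × Fin n) = projectionMoment 1 n (L * n) := by
  have : Nonempty (Fin L) := ⟨l⟩
  let K := LinearMap.range (blockIncl (n := n) l).toLinearMap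
  have hK : finrank ℝ K = n := by
    rw [LinearMap.finrank_range_of_inj (blockIncl l).injective, finrank_euclideanSpace_fin]
  have : Nontrivial K := nontrivial_of_finrank_pos (R := ℝ) (by rw [hK]; exact n.pos_of_neZero)
  have hmoment := lintegral_toSphere_norm_projection_pow K 1
  simp only [hK, finrank_euclideanSpace, Fintype.card_prod, Fintype.card_fin, K,
    norm_projection_range_blockIncl, pow_one] at hmoment
  have hmeas : Measurable fun v : USphere (Fin L × Fin n) =>
      ‖block l (v : EuclideanSpace ℝ (Fin L × Fin n))‖ := by fun_prop
  rw [integral_eq_lintegral_of_nonneg_ae (ae_of_all _ fun v => norm_nonneg _)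
    hmeas.aestronglyMeasurable, lintegral_sphereUniform_eq_of_toSphere hmoment,
    ENNReal.toReal_ofReal]
  exact (projectionMoment_pos 1 n.pos_of_neZero
    (Nat.mul_pos (Fin.pos l) n.pos_of_neZero)).le

theorem inner_multiLevel {κ : Type*} (w : Fin L → κ → USphere (Fin n)) (k : Fin L → κ)
    (v : EuclideanSpace ℝ (Fin L × Fin n)) :
    inner ℝ (multiLevel w k) v =
      1 / √L * ∑ l, inner ℝ (w l (k l) : EuclideanSpace ℝ (Fin n)) (block l v) := by
  simp only [PiLp.inner_apply, multiLevel, block, Fintype.sum_prod_type, Finset.mul_sum]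
  refine Finset.sum_congr rfl fun l _ => Finset.sum_congr rfl fun j _ => ?_
  simp only [RCLike.inner_apply, conj_trivial]
  ring

variable {κ : Type*} [Fintype κ] [Nonempty κ]

theorem refCos_multiLevel (w : Fin L → κ → USphere (Fin n))
    (v : EuclideanSpace ℝ (Fin L × Fin n)) :
    refCos (multiLevel w) v =
      1 / √L * ∑ l, maxInner (fun i => (w l i : EuclideanSpace ℝ (Fin n))) (block l v) := by
  rw [refCos_eq_maxInner]
  apply le_antisymm
  · obtain ⟨k, hk⟩ := exists_maxInner_eq (multiLevel w) v
    rw [hk, inner_multiLevel]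
    gcongr with l
    exact inner_le_maxInner (fun i => (w l i : EuclideanSpace ℝ (Fin n))) _ (k l)
  · choose k hk using fun l =>
      exists_maxInner_eq (fun i => (w l i : EuclideanSpace ℝ (Fin n))) (block l v)
    simp only [hk, ← inner_multiLevel]
    exact inner_le_maxInner (multiLevel w) v k

variable {Ω : Type*} [MeasurableSpace Ω]

theorem integrable_maxInner_block {μ : Measure Ω} [IsFiniteMeasure μ]
    {W : Ω → κ → USphere (Fin n)} (hW : ∀ i, Measurable fun ω => W ω i)
    {V : Ω → USphere (Fin L × Fin n)} (hV : Measurable V) (l : Fin L) :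
    Integrable (fun ω =>
      maxInner (fun i => (W ω i : EuclideanSpace ℝ (Fin n))) (block l (V ω))) μ := by
  have hmeas := measurable_maxInner (fun i => measurable_subtype_coe.comp (hW i))
    ((measurable_block l).comp (measurable_subtype_coe.comp hV))
  refine .of_bound hmeas.aestronglyMeasurable 1 (ae_of_all _ fun ω => ?_)
  refine (abs_maxInner_le (fun i => norm_eq_of_mem_sphere (W ω i)) _).trans ?_
  exact (norm_block_le l _).trans_eq (norm_eq_of_mem_sphere (V ω))

variable {P : Measure Ω} [IsFiniteMeasure P] [NeZero n]

theorem integral_integral_maxInner_block {W : Ω → κ → USphere (Fin n)}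
    (hW : ∀ i, Measurable fun ω => W ω i) {M : ℝ}
    (hM : ∀ x : USphere (Fin n),
      ∫ ω, maxInner (fun i => (W ω i : EuclideanSpace ℝ (Fin n))) x ∂P = M) (l : Fin L) :
    ∫ ω, ∫ v : USphere (Fin L × Fin n),
        maxInner (fun i => (W ω i : EuclideanSpace ℝ (Fin n))) (block l v)
          ∂sphereUniform (Fin L × Fin n) ∂P =
      projectionMoment 1 n (L * n) * M := by
  have : Nonempty (Fin L) := ⟨l⟩
  have hhom := integral_maxInner_eq_norm_mul (P := P)
    (S := fun ω i => (W ω i : EuclideanSpace ℝ (Fin n)))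
    fun x hx => hM ⟨x, mem_sphere_zero_iff_norm.2 hx⟩
  rw [integral_integral_swap (integrable_maxInner_block
    (W := fun p : Ω × USphere (Fin L × Fin n) => W p.1) (fun i => (hW i).comp measurable_fst)
    measurable_snd l)]
  simp only [hhom, integral_mul_const, integral_norm_block]

theorem integral_J_multiLevel [NeZero L] {W : Ω → Fin L → κ → USphere (Fin n)}
    (hW : ∀ l i, Measurable fun ω => W ω l i) {M : ℝ}
    (hM : ∀ l, ∀ x : USphere (Fin n),
      ∫ ω, maxInner (fun i => (W ω l i : EuclideanSpace ℝ (Fin n))) x ∂P = M) :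
    ∫ ω, J (multiLevel (W ω)) ∂P = √L * projectionMoment 1 n (L * n) * M := by
  have hsection (ω : Ω) (l : Fin L) : Integrable (fun v : USphere (Fin L × Fin n) =>
      maxInner (fun i => (W ω l i : EuclideanSpace ℝ (Fin n))) (block l v))
      (sphereUniform (Fin L × Fin n)) :=
    integrable_maxInner_block (W := fun _ => W ω l) (fun _ => measurable_const) measurable_id l
  have hprod (l : Fin L) := integrable_maxInner_block
    (μ := P.prod (sphereUniform (Fin L × Fin n))) (W := fun p => W p.1 l)
    (fun i => (hW l i).comp measurable_fst) measurable_snd l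
  simp only [J, refCos_multiLevel, integral_const_mul, integral_finsetSum _ fun l _ => hsection _ l]
  rw [integral_finsetSum _ fun l _ => (hprod l).integral_prod_left]
  simp only [fun l => integral_integral_maxInner_block (hW l) (hM l) l, Finset.sum_const,
    Finset.card_univ, Fintype.card_fin, nsmul_eq_mul]
  rw [← mul_assoc, one_div_mul_eq_div, Real.div_sqrt, mul_assoc]

theorem integral_J_multiLevel_pi {ν : Measure Ω} [IsProbabilityMeasure ν] [NeZero L]
    {W : Ω → κ → USphere (Fin n)}
    (hW : ∀ i, Measurable fun ω => W ω i) {M : ℝ}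
    (hM : ∀ x : USphere (Fin n),
      ∫ ω, maxInner (fun i => (W ω i : EuclideanSpace ℝ (Fin n))) x ∂ν = M) :
    ∫ ω : Fin L → Ω, J (multiLevel fun l => W (ω l)) ∂(Measure.pi fun _ => ν) =
      √L * projectionMoment 1 n (L * n) * M := by
  have hcoord (l : Fin L) (i : κ) : Measurable fun ω : Fin L → Ω => W (ω l) i :=
    (hW i).comp (measurable_pi_apply l)
  refine integral_J_multiLevel (W := fun (ω : Fin L → Ω) l => W (ω l)) hcoord fun l x => ?_
  have hmeas : Measurable fun ω =>
      maxInner (fun i => (W ω i : EuclideanSpace ℝ (Fin n))) (x : EuclideanSpace ℝ (Fin n)) :=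
    measurable_maxInner (fun i => measurable_subtype_coe.comp (hW i)) measurable_const
  exact (integral_comp_eval (μ := fun _ : Fin L => ν) (i := l) hmeas.aestronglyMeasurable).trans
    (hM x)

end Configuration

section Conclusion

variable {n : ℕ}

theorem measurable_antipodal {κ : Type*} (i : κ ⊕ κ) :
    Measurable fun w : κ → USphere (Fin n) => antipodal w i := by
  rcases i with i | i
  · exact measurable_pi_apply i
  · exact continuous_neg.measurable.comp (measurable_pi_apply i)

variable {κ : Type*} [Fintype κ] [Nonempty κ]

theorem integral_sphereUniform_real_inner_le_pow (hn : 2 ≤ n) (x : USphere (Fin n)) (p : ℕ) :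
    ∫ y in (-1 : ℝ)..1, (sphereUniform (Fin n)).real
        {u | inner ℝ (x : EuclideanSpace ℝ (Fin n)) (u : EuclideanSpace ℝ (Fin n)) ≤ y} ^ p =
      ∫ y in (-1 : ℝ)..1, cosCDF n y ^ p := by
  refine intervalIntegral.integral_congr fun y hy => ?_
  rw [uIcc_of_le (by norm_num)] at hy
  simp only [sphereUniform_real_inner_le hn x hy]

theorem integral_maxInner_uniform (hn : 2 ≤ n) (x : USphere (Fin n)) :
    ∫ w : κ → USphere (Fin n),
        maxInner (fun i => (w i : EuclideanSpace ℝ (Fin n))) (x : EuclideanSpace ℝ (Fin n))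
          ∂(Measure.pi fun _ => sphereUniform (Fin n)) =
      1 - ∫ y in (-1 : ℝ)..1, cosCDF n y ^ Fintype.card κ := by
  have : NeZero n := ⟨by omega⟩
  simp only [maxInner, real_inner_comm (x : EuclideanSpace ℝ (Fin n))]
  rw [integral_sup'_pi (X := fun u : USphere (Fin n) =>
    inner ℝ (x : EuclideanSpace ℝ (Fin n)) (u : EuclideanSpace ℝ (Fin n))) (by fun_prop)
    (abs_inner_uSphere_le_one x), integral_sphereUniform_real_inner_le_pow hn x]

theorem maxInner_antipodal (w : κ → USphere (Fin n)) (x : EuclideanSpace ℝ (Fin n)) :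
    maxInner (fun i => (antipodal w i : EuclideanSpace ℝ (Fin n))) x =
      Finset.univ.sup' Finset.univ_nonempty
        fun i => |inner ℝ x (w i : EuclideanSpace ℝ (Fin n))| := by
  apply le_antisymm
  · refine Finset.sup'_le _ _ fun i _ => ?_
    rcases i with i | i
    · refine le_trans ?_ (Finset.le_sup' _ (Finset.mem_univ i))
      simpa only [antipodal, Sum.elim_inl, real_inner_comm] using le_abs_self _
    · refine le_trans ?_ (Finset.le_sup' _ (Finset.mem_univ i))
      simpa only [antipodal, Sum.elim_inr, coe_neg_sphere, inner_neg_left,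
        real_inner_comm] using neg_le_abs _
  · refine Finset.sup'_le _ _ fun i _ => abs_le'.2 ⟨?_, ?_⟩
    · rw [real_inner_comm]
      exact inner_le_maxInner (fun i => (antipodal w i : EuclideanSpace ℝ (Fin n))) x (.inl i)
    · rw [← inner_neg_right, real_inner_comm]
      exact inner_le_maxInner (fun i => (antipodal w i : EuclideanSpace ℝ (Fin n))) x (.inr i)

theorem identDistrib_inner (hn : 2 ≤ n) (x x' : USphere (Fin n)) :
    ProbabilityTheory.IdentDistrib
      (fun u : USphere (Fin n) =>
        inner ℝ (x : EuclideanSpace ℝ (Fin n)) (u : EuclideanSpace ℝ (Fin n)))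
      (fun u : USphere (Fin n) =>
        inner ℝ (x' : EuclideanSpace ℝ (Fin n)) (u : EuclideanSpace ℝ (Fin n)))
      (sphereUniform (Fin n)) (sphereUniform (Fin n)) where
  aemeasurable_fst := by fun_prop
  aemeasurable_snd := by fun_prop
  map_eq := by rw [map_inner_sphereUniform hn, map_inner_sphereUniform hn]

theorem integral_maxInner_antipodal (hn : 2 ≤ n) (x x' : USphere (Fin n)) :
    ∫ w : κ → USphere (Fin n),
        maxInner (fun i => (antipodal w i : EuclideanSpace ℝ (Fin n)))
          (x : EuclideanSpace ℝ (Fin n)) ∂(Measure.pi fun _ => sphereUniform (Fin n)) =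
      1 - ∫ y in (-1 : ℝ)..1, (sphereUniform (Fin n)).real
        {u | |inner ℝ (x' : EuclideanSpace ℝ (Fin n)) (u : EuclideanSpace ℝ (Fin n))| ≤ y} ^
          Fintype.card κ := by
  have : NeZero n := ⟨by omega⟩
  have hlaw (y : ℝ) := congrArg ENNReal.toReal
    (((identDistrib_inner hn x x').comp measurable_norm).measure_mem_eq
      (measurableSet_Iic (a := y)))
  simp only [maxInner_antipodal]
  rw [integral_sup'_pi (X := fun u : USphere (Fin n) =>
    |inner ℝ (x : EuclideanSpace ℝ (Fin n)) (u : EuclideanSpace ℝ (Fin n))|) (by fun_prop)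
    (fun u => (abs_abs _).trans_le (abs_inner_uSphere_le_one x u))]
  exact congrArg (1 - ·) (intervalIntegral.integral_congr fun y _ => congrArg (· ^ _) (hlaw y))

theorem integral_real_abs_inner_le_pow_lt (hn : 2 ≤ n) (x : USphere (Fin n)) {k : ℕ}
    (hk : k ≠ 0) :
    ∫ y in (-1 : ℝ)..1, (sphereUniform (Fin n)).real
        {u | |inner ℝ (x : EuclideanSpace ℝ (Fin n)) (u : EuclideanSpace ℝ (Fin n))| ≤ y} ^ k <
      ∫ y in (-1 : ℝ)..1, cosCDF n y ^ (2 * k) := by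
  have : NeZero n := ⟨by omega⟩
  have hsymm := identDistrib_inner hn (-x) x
  simp only [coe_neg_sphere, inner_neg_left] at hsymm
  rw [← integral_sphereUniform_real_inner_le_pow hn x]
  refine integral_measureReal_abs_le_pow_lt (by fun_prop) hsymm (fun y hy => ?_) hk
  have hy1 : y ≤ 1 := hy.2.le.trans zero_le_one
  rw [sphereUniform_real_inner_le hn x ⟨hy.1.le, hy1⟩]
  exact cosCDF_pos hn ⟨hy.1, hy1⟩

theorem lowerBound_eq {m L : ℕ} [NeZero L] (hn : 2 ≤ n) (hm : m ≠ 0) :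
    lowerBound (L * n) n m L =
      √L * projectionMoment 1 n (L * n) * (1 - ∫ y in (-1 : ℝ)..1, cosCDF n y ^ m) := by
  have hL : (L : ℝ) ≠ 0 := NeZero.ne _
  rw [← natCast_mul_integral_mul_cosCDF_pow hn hm, lowerBound, projectionMoment]
  have hblock : (((L * n : ℕ) : ℝ) + L) / (2 * L) = ((n : ℝ) + 1) / 2 := by
    push_cast
    field_simp
  have hhalf : ((L * n : ℕ) : ℝ) / (2 * L) = (n : ℝ) / 2 := by
    push_cast
    field_simp
  rw [hblock, hhalf, Nat.cast_one]
  ring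

theorem JRan_eq_lowerBound {m L : ℕ} [NeZero L] (hn : 2 ≤ n) (hm : m ≠ 0) :
    JRan n m L = lowerBound (L * n) n m L := by
  have : NeZero m := ⟨hm⟩
  have : NeZero n := ⟨by omega⟩
  rw [lowerBound_eq hn hm]
  refine integral_J_multiLevel_pi measurable_pi_apply fun x => ?_
  rw [integral_maxInner_uniform hn, Fintype.card_fin]

theorem lowerBound_lt_JSym {k L : ℕ} [NeZero L] (hn : 2 ≤ n) (hk : k ≠ 0) :
    lowerBound (L * n) n (2 * k) L < JSym n (2 * k) L := by
  have : NeZero k := ⟨hk⟩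
  have : NeZero n := ⟨by omega⟩
  obtain ⟨x₀⟩ := nonempty_uSphere hn
  rw [lowerBound_eq hn (by omega), JSym, Nat.mul_div_cancel_left k two_pos]
  have hJ := integral_J_multiLevel_pi (L := L) (measurable_antipodal (κ := Fin k) (n := n))
    fun x => integral_maxInner_antipodal hn x x₀
  rw [hJ, Fintype.card_fin]
  have hscale : 0 < √(L : ℝ) * projectionMoment 1 n (L * n) :=
    mul_pos (Real.sqrt_pos.2 (Nat.cast_pos.2 L.pos_of_neZero))
      (projectionMoment_pos 1 n.pos_of_neZero (Nat.mul_pos L.pos_of_neZero n.pos_of_neZero))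
  exact mul_lt_mul_of_pos_left
    (sub_lt_sub_left (integral_real_abs_inner_le_pow_lt hn x₀ hk) 1) hscale

end Conclusion

end

end RefAngle

theorem lemma3p5_general (d L d' m : ℕ) (hL : 1 ≤ L) (hd : d = L * d') (hd' : 2 ≤ d')
    (hm : 1 ≤ m) :
    (Even m → RefAngle.JSym d' m L > RefAngle.lowerBound d d' m L) ∧
    RefAngle.JRan d' m L = RefAngle.lowerBound d d' m L ∧
    ∀ x : RefAngle.USphere (Fin d'),
      (RefAngle.sphereUniform (Fin d')).map
          (fun u : RefAngle.USphere (Fin d') =>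
            inner ℝ (x : EuclideanSpace ℝ (Fin d')) (u : EuclideanSpace ℝ (Fin d'))) =
        (MeasureTheory.volume.restrict (Set.Icc (-1 : ℝ) 1)).withDensity
          (fun y => ENNReal.ofReal (RefAngle.cosDensity d' y)) ∧
      ∀ y ∈ Set.Icc (-1 : ℝ) 1,
        (RefAngle.sphereUniform (Fin d')).real
          {u : RefAngle.USphere (Fin d') |
            inner ℝ (x : EuclideanSpace ℝ (Fin d')) (u : EuclideanSpace ℝ (Fin d')) ≤ y} =
        RefAngle.cosCDF d' y := by
  have : NeZero L := ⟨by omega⟩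
  subst hd
  refine ⟨fun heven => ?_, RefAngle.JRan_eq_lowerBound hd' (by omega), fun x =>
    ⟨RefAngle.map_inner_sphereUniform hd' x, fun y => RefAngle.sphereUniform_real_inner_le hd' x⟩⟩
  obtain ⟨k, rfl⟩ := even_iff_two_dvd.1 heven
  exact RefAngle.lowerBound_lt_JSym hd' (by omega)

theorem lemma3p5 (d L d' m : ℕ) (hL : 1 ≤ L) (hd : d = L * d') (hd' : 3 ≤ d') (hm : 1 ≤ m) :
    (Even m → RefAngle.JSym d' m L > RefAngle.lowerBound d d' m L) ∧
    RefAngle.JRan d' m L = RefAngle.lowerBound d d' m L ∧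
    ∀ x : RefAngle.USphere (Fin d'),
      (RefAngle.sphereUniform (Fin d')).map
          (fun u : RefAngle.USphere (Fin d') => inner ℝ (x : EuclideanSpace ℝ (Fin d')) (u : EuclideanSpace ℝ (Fin d'))) =
        (MeasureTheory.volume.restrict (Set.Icc (-1 : ℝ) 1)).withDensity
          (fun y => ENNReal.ofReal (RefAngle.cosDensity d' y)) ∧
      ∀ y ∈ Set.Icc (-1 : ℝ) 1,
        (RefAngle.sphereUniform (Fin d')).real
          {u : RefAngle.USphere (Fin d') | inner ℝ (x : EuclideanSpace ℝ (Fin d')) (u : EuclideanSpace ℝ (Fin d')) ≤ y} =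
        RefAngle.cosCDF d' y := by
  exact lemma3p5_general d L d' m hL hd (by omega) hm
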